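/- Let $(M,d)$ be a compact metric space without isolated points, let $X=M^{\mathbb Z}$ with the product topology, and let $T:X\to X$ be the full shift, $(Tx)_i=x_{i-1}$. Let $(a_n)_{n\ge 0}$ be a monotone increasing sequence of real numbers with $a_n>-1$ for all $n$, such that $\sum_{k\ge 0}\frac1{a_k+1}<\infty$ and $\lim_{k\to\infty}a_k e^{-\alpha k}=0$ for every $\alpha>0$, and endow $X$ with the metric $$r(x,y)=\sum_{n\in\mathbb Z}\min\Big\{\frac1{a_{|n|}+1},\,d(x_n,y_n)\Big\},$$ whose open balls are denoted by $B(x,\varepsilon)$. Let $\mathcal M(T)$ be the space of $T$-invariant Borel probability measures on $X$ with the weak topology. For $\mu\in\mathcal M(T)$ define the upper and lower entropy dimensions, with values in $[-\infty,+\infty]$, by $$D^+_\mu(1)=\limsup_{\varepsilon\downarrow0}\frac{\int_{\operatorname{supp}(\mu)}\log\mu(B(x,\varepsilon))\,d\mu(x)}{\log\varepsilon},\qquad D^-_\mu(1)=\liminf_{\varepsilon\downarrow0}\frac{\int_{\operatorname{supp}(\mu)}\log\mu(B(x,\varepsilon))\,d\mu(x)}{\log\varepsilon}.$$ Then each of the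 sets $$ED_-=\{\mu\in\mathcal M(T)\mid D^-_\mu(1)=0\},\qquad ED_+=\{\mu\in\mathcal M(T)\mid D^+_\mu(1)=+\infty\}$$ is residual in $\mathcal M(T)$, that is, contains a countable intersection of dense open subsets of $\mathcal M(T)$. -/

import Mathlib

open MeasureTheory Filter Topology

noncomputable section

namespace FullShift

/-- The full shift on bi-infinite sequences: `(T x)_i = x_{i-1}`. -/
def shift (M : Type*) (x : ℤ → M) : ℤ → M := fun i => x (i - 1)

/-- The conditions on the sequence `a` for the metric below to be sub-exponential.
The condition `-1 < a n` says that the weights `1 / (a n + 1)` are positive. -/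
structure IsSubexponential (a : ℕ → ℝ) : Prop where
  neg_one_lt : ∀ n, -1 < a n
  monotone : Monotone a
  summable : Summable fun k => 1 / (a k + 1)
  tendsto : ∀ α : ℝ, 0 < α → Tendsto (fun k : ℕ => a k / Real.exp (α * k)) atTop (𝓝 0)

/-- The metric `r(x,y) = ∑_{n ∈ ℤ} min {1 / (a_{|n|} + 1), d(x_n, y_n)}` on `ℤ → M`. The series
converges whenever `a` is sub-exponential, its terms being nonnegative and dominated by the
summable weights. -/
def seqDist {M : Type*} [MetricSpace M] (a : ℕ → ℝ) (x y : ℤ → M) : ℝ :=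
  ∑' n : ℤ, min (1 / (a n.natAbs + 1)) (dist (x n) (y n))

/-- The open ball `B(x, ε)` for the metric `seqDist a`. -/
def ball {M : Type*} [MetricSpace M] (a : ℕ → ℝ) (x : ℤ → M) (ε : ℝ) : Set (ℤ → M) :=
  {y | seqDist a x y < ε}

/-- The quotient `(∫_{supp μ} log μ(B(x, ε)) dμ(x)) / log ε`. If `M` is compact and `a` is
sub-exponential, the integrand is bounded on `supp μ` for every `ε > 0`. -/
def entropyQuotient {M : Type*} [MetricSpace M] [MeasurableSpace M] (a : ℕ → ℝ)
    (μ : Measure (ℤ → M)) (ε : ℝ) : ℝ :=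
  (∫ x in μ.support, Real.log (μ.real (ball a x ε)) ∂μ) / Real.log ε

/-- The upper entropy dimension `D⁺_μ(1)`, an extended real number. -/
def upperEntropyDim {M : Type*} [MetricSpace M] [MeasurableSpace M] (a : ℕ → ℝ)
    (μ : Measure (ℤ → M)) : EReal :=
  limsup (fun ε : ℝ => (entropyQuotient a μ ε : EReal)) (𝓝[>] 0)

/-- The lower entropy dimension `D⁻_μ(1)`, an extended real number. -/
def lowerEntropyDim {M : Type*} [MetricSpace M] [MeasurableSpace M] (a : ℕ → ℝ)
    (μ : Measure (ℤ → M)) : EReal :=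
  liminf (fun ε : ℝ => (entropyQuotient a μ ε : EReal)) (𝓝[>] 0)

/-- The space `M(T)` of shift-invariant Borel probability measures on `ℤ → M`; as a subtype of
`ProbabilityMeasure` it carries the weak topology. -/
abbrev InvariantMeasure (M : Type*) [MeasurableSpace M] : Type _ :=
  {μ : ProbabilityMeasure (ℤ → M) //
    MeasurePreserving (shift M) (μ : Measure (ℤ → M)) (μ : Measure (ℤ → M))}

end FullShift

end

/-! Since `log μ(B) ≤ 0`, the quotient is nonnegative for `ε < 1`. It therefore suffices that, for
each `m`, a small (resp. large) quotient at some scale below `1 / (m + 1)` holds on a neighbourhood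
of every point of a dense set; the interiors for varying `m` then give the countable intersection.

For `ED_-` the dense set is `finitelySupported`. If `μ` is carried by a finite set `F`, the integral
of `-log μ(B(x, ε))` stays bounded in terms of `log #F` while `-log ε → ∞`. At a fixed `ε` this
survives for every `ν` that puts enough mass near `F` (`finitelySupported_subset_interior`). Density
comes from rounding symbols to a finite alphabet and averaging periodizations.

For `ED_+` the dense set is `smallCylinders`, obtained by letting independent fair bits choose
between two nearby symbols; this is where the absence of isolated points enters. At the scale `1 /
(a N + 1)` a ball sees all symbols in `[-N, N]`, so the integral is at least of order `N`, whereas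
`log (a N + 1) = o(N)` by subexponential growth (`smallCylinders_subset_interior`). -/

namespace FullShift

/-! ### The metric and small open covers -/

section Metric

variable {M : Type*} [MetricSpace M] {a : ℕ → ℝ}

lemma IsSubexponential.weight_pos (ha : IsSubexponential a) (n : ℕ) : 0 < 1 / (a n + 1) :=
  one_div_pos.2 (by linarith [ha.neg_one_lt n])

lemma IsSubexponential.summable_int (ha : IsSubexponential a) :
    Summable fun n : ℤ => 1 / (a n.natAbs + 1) :=
  Summable.of_nat_of_neg (by simpa using ha.summable) (by simpa using ha.summable)

lemma seqDist_term_nonneg (ha : IsSubexponential a) (x y : ℤ → M) (n : ℤ) :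
    0 ≤ min (1 / (a n.natAbs + 1)) (dist (x n) (y n)) :=
  le_min (ha.weight_pos _).le dist_nonneg

lemma summable_seqDist (ha : IsSubexponential a) (x y : ℤ → M) :
    Summable fun n : ℤ => min (1 / (a n.natAbs + 1)) (dist (x n) (y n)) :=
  ha.summable_int.of_nonneg_of_le (seqDist_term_nonneg ha x y) fun _ => min_le_left _ _

lemma seqDist_self (ha : IsSubexponential a) (x : ℤ → M) : seqDist a x x = 0 := by
  have h (n : ℤ) : min (1 / (a n.natAbs + 1)) (dist (x n) (x n)) = 0 := by
    rw [dist_self]; exact min_eq_right (ha.weight_pos _).le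
  simp only [seqDist, h, tsum_zero]

lemma continuous_seqDist (ha : IsSubexponential a) :
    Continuous fun p : (ℤ → M) × (ℤ → M) => seqDist a p.1 p.2 := by
  refine continuous_tsum (u := fun n : ℤ => 1 / (a n.natAbs + 1)) (fun n => ?_)
    ha.summable_int fun n p => ?_
  · fun_prop
  · rw [Real.norm_of_nonneg (seqDist_term_nonneg ha p.1 p.2 n)]
    exact min_le_left _ _

lemma min_le_seqDist (ha : IsSubexponential a) (x y : ℤ → M) (n : ℤ) :
    min (1 / (a n.natAbs + 1)) (dist (x n) (y n)) ≤ seqDist a x y :=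
  (summable_seqDist ha x y).le_tsum n fun k _ => seqDist_term_nonneg ha x y k

lemma exists_isOpen_seqDist_lt (ha : IsSubexponential a) (x : ℤ → M) {ε : ℝ} (hε : 0 < ε) :
    ∃ U : Set (ℤ → M), IsOpen U ∧ x ∈ U ∧ ∀ y ∈ U, ∀ z ∈ U, seqDist a y z < ε := by
  have h : ∀ᶠ p in 𝓝 (x, x), seqDist a p.1 p.2 < ε :=
    (continuous_seqDist ha).continuousAt.eventually_lt continuousAt_const
      (by simpa [seqDist_self ha] using hε)
  obtain ⟨U, V, hU, hxU, hV, hxV, h⟩ := mem_nhds_prod_iff'.1 h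
  exact ⟨U ∩ V, hU.inter hV, ⟨hxU, hxV⟩, fun y hy z hz => h (Set.mk_mem_prod hy.1 hz.2)⟩

lemma exists_finite_cover_seqDist_lt [CompactSpace M] (ha : IsSubexponential a) {ε : ℝ}
    (hε : 0 < ε) :
    ∃ (t : Finset (ℤ → M)) (V : (ℤ → M) → Set (ℤ → M)), (∀ x, IsOpen (V x)) ∧
      (∀ x, ∀ y ∈ V x, ∀ z ∈ V x, seqDist a y z < ε) ∧ ⋃ x ∈ t, V x = Set.univ := by
  choose V hV hxV h using fun x : ℤ → M => exists_isOpen_seqDist_lt ha x hε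
  obtain ⟨t, ht⟩ := isCompact_univ.elim_finite_subcover V hV
    fun x _ => Set.mem_iUnion.2 ⟨x, hxV x⟩
  exact ⟨t, V, hV, h, Set.univ_subset_iff.1 ht⟩

end Metric

/-! ### Bounds for the integral of `-log μ(B(x, ε))` -/

section Entropy

variable {M : Type*} [MetricSpace M] [CompactSpace M] [MeasurableSpace M] [BorelSpace M]
  {a : ℕ → ℝ} (μ : Measure (ℤ → M)) [IsProbabilityMeasure μ]

lemma measurable_measureReal_ball (ha : IsSubexponential a) (ε : ℝ) :
    Measurable fun x => μ.real (ball a x ε) :=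
  (measurable_measure_prodMk_left (ν := μ) (s := {p | seqDist a p.1 p.2 < ε})
    ((isOpen_lt (continuous_seqDist ha) continuous_const).measurableSet)).ennreal_toReal

variable {μ}

/-- A point of `U i` has `U i` inside its ball, so `1 / μ(B)` is at most the sum of the functions
`1_{U i} / μ(U i)`, each of integral at most 1. Null sets `U i` are avoided almost everywhere. -/
lemma inv_measureReal_ball_integrableOn {ι : Type*} (ha : IsSubexponential a) {ε : ℝ}
    (t : Finset ι) (U : ι → Set (ℤ → M)) (hU : ∀ i, MeasurableSet (U i))
    (hdiam : ∀ i, ∀ y ∈ U i, ∀ z ∈ U i, seqDist a y z < ε) {S : Set (ℤ → M)}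
    (hS : MeasurableSet S) (hSU : S ⊆ ⋃ i ∈ t, U i) :
    (∀ᵐ x ∂μ, x ∈ S → 0 < μ.real (ball a x ε)) ∧
      IntegrableOn (fun x => (μ.real (ball a x ε))⁻¹) S μ ∧
        ∫ x in S, (μ.real (ball a x ε))⁻¹ ∂μ ≤ t.card := by
  have hpos : ∀ᵐ x ∂μ, ∀ i ∈ t, x ∈ U i → 0 < μ.real (U i) := by
    rw [Filter.eventually_all_finset]
    intro i _
    by_cases h : μ (U i) = 0
    · filter_upwards [measure_eq_zero_iff_ae_notMem.1 h] with x hx hx'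
      exact absurd hx' hx
    · exact ae_of_all _ fun x _ => ENNReal.toReal_pos h (measure_ne_top _ _)
  have hle (x : ℤ → M) (i : ι) (hx : x ∈ U i) : μ.real (U i) ≤ μ.real (ball a x ε) :=
    measureReal_mono fun y hy => hdiam i x hx y hy
  set H : (ℤ → M) → ℝ := fun x => ∑ i ∈ t, (U i).indicator (fun _ => (μ.real (U i))⁻¹) x with hH
  have hHi (i : ι) : Integrable ((U i).indicator fun _ => (μ.real (U i))⁻¹) μ :=
    (integrable_const _).indicator (hU i)
  have hHint : Integrable H μ := integrable_finsetSum _ fun i _ => hHi i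
  have hH0 (x : ℤ → M) (i : ι) : 0 ≤ (U i).indicator (fun _ => (μ.real (U i))⁻¹) x :=
    Set.indicator_nonneg (fun _ _ => inv_nonneg.2 measureReal_nonneg) x
  have hbound : ∀ᵐ x ∂μ, x ∈ S → 0 < μ.real (ball a x ε) ∧ (μ.real (ball a x ε))⁻¹ ≤ H x := by
    filter_upwards [hpos] with x hx hxS
    obtain ⟨i, hi, hxi⟩ := Set.mem_iUnion₂.1 (hSU hxS)
    have h1 := hx i hi hxi
    refine ⟨h1.trans_le (hle x i hxi), (inv_anti₀ h1 (hle x i hxi)).trans ?_⟩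
    have h2 := Finset.single_le_sum (f := fun i => (U i).indicator (fun _ => (μ.real (U i))⁻¹) x)
      (fun i _ => hH0 x i) hi
    simpa [Set.indicator_of_mem hxi] using h2
  have hint : IntegrableOn (fun x => (μ.real (ball a x ε))⁻¹) S μ := by
    refine hHint.integrableOn.mono' (measurable_measureReal_ball μ ha ε).inv.aestronglyMeasurable ?_
    filter_upwards [(ae_restrict_iff' hS).2 hbound] with x hx
    rw [Real.norm_of_nonneg (inv_nonneg.2 measureReal_nonneg)]
    exact hx.2
  refine ⟨hbound.mono fun x h hx => (h hx).1, hint, ?_⟩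
  calc ∫ x in S, (μ.real (ball a x ε))⁻¹ ∂μ ≤ ∫ x in S, H x ∂μ :=
        integral_mono_ae hint hHint.integrableOn
          (((ae_restrict_iff' hS).2 hbound).mono fun x hx => hx.2)
    _ ≤ ∫ x, H x ∂μ := setIntegral_le_integral hHint
        (ae_of_all _ fun x => Finset.sum_nonneg fun i _ => hH0 x i)
    _ = ∑ i ∈ t, μ.real (U i) * (μ.real (U i))⁻¹ := by
        rw [hH, integral_finsetSum _ fun i _ => hHi i]
        refine Finset.sum_congr rfl fun i _ => ?_
        rw [integral_indicator (hU i), setIntegral_const, smul_eq_mul]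
    _ ≤ ∑ i ∈ t, (1 : ℝ) := Finset.sum_le_sum fun i _ => mul_inv_le_one
    _ = t.card := by simp

lemma ae_measureReal_ball_pos_and_integrable (ha : IsSubexponential a) {ε : ℝ} (hε : 0 < ε) :
    (∀ᵐ x ∂μ, 0 < μ.real (ball a x ε)) ∧
      Integrable (fun x => (μ.real (ball a x ε))⁻¹) μ := by
  obtain ⟨t, V, hV, hd, ht⟩ := exists_finite_cover_seqDist_lt (M := M) ha hε
  obtain ⟨h1, h2, -⟩ := inv_measureReal_ball_integrableOn (μ := μ) ha t V
    (fun i => (hV i).measurableSet) hd MeasurableSet.univ ht.ge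
  exact ⟨h1.mono fun x h => h (Set.mem_univ x), integrableOn_univ.1 h2⟩

/-- This is `log u ≤ u - 1` at `u = 1 / (n p)`. It plays the role of Jensen's inequality, turning a
bound `n` on the integral of `1 / p` into `log n` plus a constant. -/
lemma neg_log_le_log_add {p n : ℝ} (hp : 0 < p) (hn : 0 < n) :
    -Real.log p ≤ Real.log n + n⁻¹ * p⁻¹ := by
  have h := Real.log_le_sub_one_of_pos (x := n⁻¹ * p⁻¹) (by positivity)
  rw [Real.log_mul (by positivity) (by positivity), Real.log_inv, Real.log_inv] at h
  linarith

lemma integrable_log_measureReal_ball (ha : IsSubexponential a) {ε : ℝ} (hε : 0 < ε) :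
    Integrable (fun x => Real.log (μ.real (ball a x ε))) μ := by
  obtain ⟨hpos, hint⟩ := ae_measureReal_ball_pos_and_integrable (μ := μ) ha hε
  refine hint.mono' (measurable_measureReal_ball μ ha ε).log.aestronglyMeasurable ?_
  filter_upwards [hpos] with x hx
  have h1 : Real.log (μ.real (ball a x ε)) ≤ 0 := Real.log_nonpos hx.le measureReal_le_one
  have h2 := neg_log_le_log_add hx one_pos
  rw [Real.norm_of_nonpos h1]
  simpa using h2

-- The support has full measure, so restricting to it changes nothing. The signs make numerator and
-- denominator nonnegative for `ε < 1`.
omit [BorelSpace M] [IsProbabilityMeasure μ] in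
lemma entropyQuotient_eq (ε : ℝ) :
    entropyQuotient a μ ε = (∫ x, -Real.log (μ.real (ball a x ε)) ∂μ) / (-Real.log ε) := by
  rw [entropyQuotient, integral_neg, neg_div_neg_eq, Measure.restrict_eq_self_of_ae_mem]
  exact Measure.support_mem_ae

omit [BorelSpace M] in
lemma entropyQuotient_nonneg {ε : ℝ} (hε : 0 < ε) (hε1 : ε < 1) : 0 ≤ entropyQuotient a μ ε := by
  rw [entropyQuotient_eq]
  refine div_nonneg (integral_nonneg fun x => ?_) (neg_nonneg.2 (Real.log_nonpos hε.le hε1.le))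
  exact neg_nonneg.2 (Real.log_nonpos measureReal_nonneg measureReal_le_one)

lemma setIntegral_neg_log_measureReal_ball_le {ι : Type*} (ha : IsSubexponential a) {ε : ℝ}
    (hε : 0 < ε) (t : Finset ι) (U : ι → Set (ℤ → M)) (hU : ∀ i, MeasurableSet (U i))
    (hdiam : ∀ i, ∀ y ∈ U i, ∀ z ∈ U i, seqDist a y z < ε) {S : Set (ℤ → M)}
    (hS : MeasurableSet S) (hSU : S ⊆ ⋃ i ∈ t, U i) (ht : t.Nonempty) :
    ∫ x in S, -Real.log (μ.real (ball a x ε)) ∂μ ≤ μ.real S * Real.log t.card + 1 := by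
  obtain ⟨hpos, hint, hle⟩ := inv_measureReal_ball_integrableOn (μ := μ) ha t U hU hdiam hS hSU
  have ht0 : (0 : ℝ) < t.card := by exact_mod_cast ht.card_pos
  calc ∫ x in S, -Real.log (μ.real (ball a x ε)) ∂μ
      ≤ ∫ x in S, (Real.log t.card + (t.card : ℝ)⁻¹ * (μ.real (ball a x ε))⁻¹) ∂μ := by
        refine integral_mono_ae (integrable_log_measureReal_ball ha hε).neg.integrableOn
          ((integrable_const _).add (hint.const_mul _)) ?_
        filter_upwards [(ae_restrict_iff' hS).2 hpos] with x hx
        exact neg_log_le_log_add hx ht0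
    _ = μ.real S * Real.log t.card +
          (t.card : ℝ)⁻¹ * ∫ x in S, (μ.real (ball a x ε))⁻¹ ∂μ := by
        rw [integral_add (integrable_const _) (hint.const_mul _), setIntegral_const, smul_eq_mul,
          integral_const_mul]
    _ ≤ μ.real S * Real.log t.card + (t.card : ℝ)⁻¹ * t.card := by gcongr
    _ = _ := by rw [inv_mul_cancel₀ ht0.ne']

/-- The few sets of `s` are meant to carry almost all the mass; the large cover `t` is paid for only
on the remainder. -/
lemma integral_neg_log_measureReal_ball_le {ι κ : Type*} (ha : IsSubexponential a) {ε : ℝ}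
    (hε : 0 < ε) (s : Finset ι) (U : ι → Set (ℤ → M)) (hU : ∀ i, MeasurableSet (U i))
    (hUd : ∀ i, ∀ y ∈ U i, ∀ z ∈ U i, seqDist a y z < ε) (hs : s.Nonempty)
    (t : Finset κ) (V : κ → Set (ℤ → M)) (hV : ∀ i, MeasurableSet (V i))
    (hVd : ∀ i, ∀ y ∈ V i, ∀ z ∈ V i, seqDist a y z < ε) (ht : t.Nonempty)
    (htV : ⋃ i ∈ t, V i = Set.univ) :
    ∫ x, -Real.log (μ.real (ball a x ε)) ∂μ ≤
      Real.log s.card + (1 - μ.real (⋃ i ∈ s, U i)) * Real.log t.card + 2 := by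
  have hm : MeasurableSet (⋃ i ∈ s, U i) := s.measurableSet_biUnion fun i _ => hU i
  have hint : Integrable (fun x => -Real.log (μ.real (ball a x ε))) μ :=
    (integrable_log_measureReal_ball ha hε).neg
  rw [← integral_add_compl hm hint]
  have h1 := setIntegral_neg_log_measureReal_ball_le (μ := μ) ha hε s U hU hUd hm subset_rfl hs
  have h2 := setIntegral_neg_log_measureReal_ball_le (μ := μ) ha hε t V hV hVd hm.compl
    (by simp [htV]) ht
  rw [probReal_compl_eq_one_sub hm] at h2
  have h3 : μ.real (⋃ i ∈ s, U i) * Real.log s.card ≤ 1 * Real.log s.card :=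
    mul_le_mul_of_nonneg_right measureReal_le_one (Real.log_natCast_nonneg _)
  linarith

lemma le_integral_neg_log_measureReal_ball (ha : IsSubexponential a) {ε s : ℝ} (hε : 0 < ε)
    {U : Set (ℤ → M)} (hU : MeasurableSet U)
    (h : ∀ x ∈ U, μ.real (ball a x ε) ≤ s) :
    μ.real U * -Real.log s ≤ ∫ x, -Real.log (μ.real (ball a x ε)) ∂μ := by
  have hint := (integrable_log_measureReal_ball (μ := μ) ha hε).neg
  calc μ.real U * -Real.log s = ∫ x in U, -Real.log s ∂μ := by
        rw [setIntegral_const, smul_eq_mul]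
    _ ≤ ∫ x in U, -Real.log (μ.real (ball a x ε)) ∂μ := by
        refine integral_mono_ae (integrable_const _) hint.integrableOn
          ((ae_restrict_iff' hU).2 ?_)
        filter_upwards [(ae_measureReal_ball_pos_and_integrable (μ := μ) ha hε).1] with x hx hxU
        exact neg_le_neg (Real.log_le_log hx (h x hxU))
    _ ≤ _ := setIntegral_le_integral hint (ae_of_all _ fun x =>
        neg_nonneg.2 (Real.log_nonpos measureReal_nonneg measureReal_le_one))

end Entropy

/-! ### Coding by independent fair bits -/

section Coding

variable {M : Type*} [MeasurableSpace M]

lemma measurable_shift : Measurable (shift M) :=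
  measurable_pi_lambda _ fun i => measurable_pi_apply (i - 1)

/-- The law of a sequence of independent fair bits. -/
noncomputable def fairBits : Measure (ℤ → Bool) :=
  Measure.infinitePi fun _ => (PMF.uniformOfFintype Bool).toMeasure

instance : IsProbabilityMeasure fairBits := by unfold fairBits; infer_instance

lemma measurePreserving_shift_fairBits : MeasurePreserving (shift Bool) fairBits fairBits := by
  refine ⟨measurable_shift, ?_⟩
  have h := Measure.infinitePi_map_piCongrLeft (X := fun _ : ℤ => Bool)
    (μ := fun _ => (PMF.uniformOfFintype Bool).toMeasure) (Equiv.addRight (1 : ℤ))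
  rw [fairBits]
  convert h using 2
  ext x i
  have h' := Equiv.piCongrLeft_apply_apply (fun _ : ℤ => Bool) (Equiv.addRight 1) x (i - 1)
  simp only [Equiv.coe_addRight, sub_add_cancel] at h'
  exact h'.symm

lemma fairBits_pi_le (s : Finset ℤ) (t : ℤ → Set Bool) (ht : ∀ n, (t n).Subsingleton) :
    fairBits ((s : Set ℤ).pi t) ≤ 2⁻¹ ^ s.card := by
  rw [fairBits, Measure.infinitePi_pi _ fun _ _ => (t _).toFinite.measurableSet,
    ← Finset.prod_const]
  refine Finset.prod_le_prod' fun n _ => ?_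
  rcases (ht n).eq_empty_or_singleton with h | ⟨b, h⟩
  · simp [h]
  · rw [h, PMF.toMeasure_apply_singleton _ _ (measurableSet_singleton b)]
    simp

/-- Apply `g` to each symbol of a sequence together with a bit. -/
def bitCode (g : M × Bool → M) (p : (ℤ → M) × (ℤ → Bool)) : ℤ → M := fun n => g (p.1 n, p.2 n)

lemma measurable_bitCode {g : M × Bool → M} (hg : Measurable g) : Measurable (bitCode g) :=
  measurable_pi_lambda _ fun n => hg.comp
    (((measurable_pi_apply n).comp measurable_fst).prodMk
      ((measurable_pi_apply n).comp measurable_snd))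

/-- The law of the sequence `g (x n, ξ n)`, where `x` has law `μ` and the `ξ n` are
independent fair bits. -/
noncomputable def InvariantMeasure.code (μ : InvariantMeasure M) {g : M × Bool → M} (hg : Measurable g) :
    InvariantMeasure M :=
  ⟨⟨((μ.1 : Measure (ℤ → M)).prod fairBits).map (bitCode g),
      Measure.isProbabilityMeasure_map (measurable_bitCode hg).aemeasurable⟩, by
    have h := μ.2.prod measurePreserving_shift_fairBits
    refine ⟨measurable_shift, ?_⟩
    rw [ProbabilityMeasure.coe_mk, Measure.map_map measurable_shift (measurable_bitCode hg)]
    conv_rhs => rw [← h.map_eq, Measure.map_map (measurable_bitCode hg) h.measurable]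
    rfl⟩

lemma InvariantMeasure.coe_code (μ : InvariantMeasure M) {g : M × Bool → M} (hg : Measurable g) :
    ((μ.code hg).1 : Measure (ℤ → M)) =
      ((μ.1 : Measure (ℤ → M)).prod fairBits).map (bitCode g) := rfl

lemma InvariantMeasure.code_pi_eq_one (μ : InvariantMeasure M) {g : M × Bool → M}
    (hg : Measurable g) {C : Set M} (hC : MeasurableSet C) (h : ∀ p, g p ∈ C) :
    ((μ.code hg).1 : Measure (ℤ → M)) {x | ∀ n, x n ∈ C} = 1 := by
  have hm : MeasurableSet {x : ℤ → M | ∀ n, x n ∈ C} := by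
    rw [Set.ofPred_forall]
    exact MeasurableSet.iInter fun n => measurable_pi_apply n hC
  rw [coe_code, Measure.map_apply (measurable_bitCode hg) hm]
  convert measure_univ (μ := (μ.1 : Measure (ℤ → M)).prod fairBits)
  ext p
  simp [bitCode, h]

/-- By Fubini: for fixed `x`, each position in `s` admits at most one bit producing the prescribed
symbol. -/
lemma InvariantMeasure.code_cylinder_le [MeasurableSingletonClass M] (μ : InvariantMeasure M)
    {g : M × Bool → M} (hg : Measurable g) (hinj : ∀ m, g (m, false) ≠ g (m, true))
    (s : Finset ℤ) (w : ℤ → M) :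
    ((μ.code hg).1 : Measure (ℤ → M)) {x | ∀ n ∈ s, x n = w n} ≤ 2⁻¹ ^ s.card := by
  have hm : MeasurableSet {x : ℤ → M | ∀ n ∈ s, x n = w n} := by
    simp only [Set.ofPred_forall]
    exact MeasurableSet.iInter fun n => MeasurableSet.iInter fun _ =>
      (measurable_pi_apply n : Measurable fun x : ℤ → M => x n) (measurableSet_singleton (w n))
  rw [coe_code, Measure.map_apply (measurable_bitCode hg) hm,
    Measure.prod_apply (measurable_bitCode hg hm)]
  calc _ ≤ ∫⁻ _, 2⁻¹ ^ s.card ∂(μ.1 : Measure (ℤ → M)) := by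
        refine lintegral_mono fun x => ?_
        refine le_trans (measure_mono ?_)
          (fairBits_pi_le s (fun n => {b | g (x n, b) = w n}) fun n b hb c hc => ?_)
        · intro ξ hξ n hn
          exact hξ n hn
        · have h := hinj (x n)
          simp only [Set.mem_ofPred_eq] at hb hc
          cases b <;> cases c <;> simp_all
    _ = _ := by simp

end Coding

/-! ### Two dense families obtained by coding -/

section Convergence

variable {M : Type*} [MetricSpace M] [CompactSpace M] [MeasurableSpace M] [BorelSpace M]

/-- All the coded measures and `μ` are images of one product measure, under maps converging
pointwise, so dominated convergence applies. -/
lemma InvariantMeasure.tendsto_code (μ : InvariantMeasure M) {g : ℕ → M × Bool → M}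
    (hg : ∀ k, Measurable (g k)) (h : ∀ p : M × Bool, Tendsto (fun k => g k p) atTop (𝓝 p.1)) :
    Tendsto (fun k => μ.code (hg k)) atTop (𝓝 μ) := by
  rw [tendsto_subtype_rng, ProbabilityMeasure.tendsto_iff_forall_integral_tendsto]
  intro f
  have h1 : ∫ x, f x ∂(μ.1 : Measure (ℤ → M)) =
      ∫ p, f p.1 ∂((μ.1 : Measure (ℤ → M)).prod fairBits) := by
    conv_lhs => rw [← (measurePreserving_fst (μ := (μ.1 : Measure (ℤ → M)))
      (ν := fairBits)).map_eq]
    exact integral_map measurable_fst.aemeasurable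
      f.continuous.aestronglyMeasurable
  rw [h1]
  have h2 (k : ℕ) : ∫ x, f x ∂((μ.code (hg k)).1 : Measure (ℤ → M)) =
      ∫ p, f (bitCode (g k) p) ∂((μ.1 : Measure (ℤ → M)).prod fairBits) := by
    rw [coe_code]
    exact integral_map (measurable_bitCode (hg k)).aemeasurable
      f.continuous.aestronglyMeasurable
  simp only [h2]
  refine tendsto_integral_of_dominated_convergence (fun _ => ‖f‖)
    (fun k => (f.continuous.measurable.comp (measurable_bitCode (hg k))).aestronglyMeasurable)
    (integrable_const _) (fun k => ae_of_all _ fun p => f.norm_coe_le_norm _)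
    (ae_of_all _ fun p => ?_)
  exact (f.continuous.tendsto _).comp (tendsto_pi_nhds.2 fun n => h (p.1 n, p.2 n))

lemma exists_simpleFunc_dist_lt [Nonempty M] {δ : ℝ} (hδ : 0 < δ) :
    ∃ c : SimpleFunc M M, ∀ x, dist (c x) x < δ := by
  obtain ⟨t, ht⟩ := isCompact_univ.elim_finite_subcover
    (fun k => Metric.ball (TopologicalSpace.denseSeq M k) δ) (fun _ => Metric.isOpen_ball)
    fun x _ => by
      obtain ⟨k, hk⟩ := (TopologicalSpace.denseRange_denseSeq M).exists_dist_lt x hδ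
      exact Set.mem_iUnion.2 ⟨k, hk⟩
  refine ⟨SimpleFunc.nearestPt (TopologicalSpace.denseSeq M) (t.sup id), fun x => ?_⟩
  obtain ⟨k, hk, hx⟩ := Set.mem_iUnion₂.1 (ht (Set.mem_univ x))
  have h := SimpleFunc.edist_nearestPt_le (TopologicalSpace.denseSeq M) x
    (Finset.le_sup (f := id) hk)
  rw [edist_dist, edist_dist] at h
  rw [Metric.mem_ball, dist_comm] at hx
  exact ((ENNReal.ofReal_le_ofReal_iff dist_nonneg).1 h).trans_lt hx

omit [MetricSpace M] [CompactSpace M] [BorelSpace M] in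
lemma InvariantMeasure.nonempty_alphabet (μ : InvariantMeasure M) : Nonempty M :=
  (nonempty_of_isProbabilityMeasure (μ.1 : Measure (ℤ → M))).map fun x => x 0

lemma InvariantMeasure.mem_closure_of_code (μ : InvariantMeasure M) {S : Set (InvariantMeasure M)}
    (h : ∀ δ > 0, ∃ (g : M × Bool → M) (hg : Measurable g), (∀ p, dist (g p) p.1 < δ) ∧
      μ.code hg ∈ S) : μ ∈ closure S := by
  choose g hg hd hS using fun k : ℕ => h (1 / ((k : ℝ) + 1)) (by positivity)
  refine mem_closure_of_tendsto (μ.tendsto_code hg fun p => ?_) (Eventually.of_forall hS)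
  rw [tendsto_iff_dist_tendsto_zero]
  exact squeeze_zero (fun _ => dist_nonneg) (fun k => (hd k p).le)
    tendsto_one_div_add_atTop_nhds_zero_nat

/-- Invariant measures carried by the sequences in finitely many symbols. -/
def finiteAlphabet (M : Type*) [MeasurableSpace M] : Set (InvariantMeasure M) :=
  {μ | ∃ C : Set M, C.Finite ∧ (μ.1 : Measure (ℤ → M)) {x | ∀ n, x n ∈ C} = 1}

/-- Invariant measures carried by the sequences in finitely many symbols whose cylinders over `s`
have measure at most `2⁻¹ ^ #s`. -/
def smallCylinders (M : Type*) [MeasurableSpace M] : Set (InvariantMeasure M) :=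
  {μ | (∃ C : Set M, C.Finite ∧ (μ.1 : Measure (ℤ → M)) {x | ∀ n, x n ∈ C} = 1) ∧
    ∀ (s : Finset ℤ) (w : ℤ → M),
      (μ.1 : Measure (ℤ → M)) {x | ∀ n ∈ s, x n = w n} ≤ 2⁻¹ ^ s.card}

lemma dense_finiteAlphabet : Dense (finiteAlphabet M) := by
  intro μ
  have := μ.nonempty_alphabet
  refine μ.mem_closure_of_code fun δ hδ => ?_
  obtain ⟨c, hc⟩ := exists_simpleFunc_dist_lt (M := M) hδ
  exact ⟨fun p => c p.1, c.measurable.comp measurable_fst, fun p => hc p.1,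
    Set.range c, c.finite_range, μ.code_pi_eq_one _ c.finite_range.measurableSet fun p => ⟨_, rfl⟩⟩

lemma dense_smallCylinders [PerfectSpace M] : Dense (smallCylinders M) := by
  intro μ
  have := μ.nonempty_alphabet
  refine μ.mem_closure_of_code fun δ hδ => ?_
  obtain ⟨c, hc⟩ := exists_simpleFunc_dist_lt (M := M) (half_pos hδ)
  -- Perfectness gives each symbol a distinct close companion; the bit chooses between the two.
  have hp (m : M) : ∃ p, p ≠ m ∧ dist p m < δ / 2 := by
    have h : ∃ᶠ p in 𝓝 m, p ≠ m :=
      accPt_iff_frequently.1 (PerfectSpace.univ_preperfect m (Set.mem_univ m)) |>.mono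
        fun _ h => h.1
    exact (h.and_eventually (Metric.ball_mem_nhds m (half_pos hδ))).exists
  choose q hq hqd using hp
  let g : M × Bool → M := fun p => if p.2 then c.map q p.1 else c p.1
  have hg : Measurable g := Measurable.ite
    (measurable_snd (measurableSet_singleton true))
    ((c.map q).measurable.comp measurable_fst) (c.measurable.comp measurable_fst)
  have hC : (Set.range c ∪ Set.range (c.map q)).Finite :=
    c.finite_range.union (c.map q).finite_range
  refine ⟨g, hg, ?_, ⟨_, hC, μ.code_pi_eq_one hg hC.measurableSet ?_⟩,
    μ.code_cylinder_le hg fun m => ?_⟩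
  · rintro ⟨m, _ | _⟩
    · simpa [g] using (hc m).trans (half_lt_self hδ)
    · simpa [g] using (dist_triangle _ (c m) m).trans_lt (by linarith [hqd (c m), hc m])
  · rintro ⟨m, _ | _⟩ <;> simp [g]
  · simpa [g] using (hq (c m)).symm

end Convergence

/-! ### Periodization -/

section Periodize

variable {M : Type*}

/-- The `L`-periodic sequence which agrees with `x` on `[-i, L - i)`. -/
def periodize (L i : ℕ) (x : ℤ → M) : ℤ → M := fun n => x ((n + i) % L - i)

lemma shift_periodize_succ (L i : ℕ) (x : ℤ → M) :
    shift M (periodize L (i + 1) x) = periodize L i (shift M x) := by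
  ext n
  simp only [shift, periodize, Nat.cast_add, Nat.cast_one]
  congr 1
  rw [show n - 1 + ((i : ℤ) + 1) = n + i by ring]
  ring

lemma shift_iterate (k : ℕ) (x : ℤ → M) (n : ℤ) : (shift M)^[k] x n = x (n - k) := by
  induction k generalizing x with
  | zero => simp
  | succ k ih =>
    rw [Function.iterate_succ_apply, ih]
    simp only [shift, Nat.cast_add, Nat.cast_one]
    congr 1
    ring

lemma periodize_self (L : ℕ) (x : ℤ → M) :
    periodize L L x = periodize L 0 ((shift M)^[L] x) := by
  ext n
  simp [periodize, shift_iterate]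

lemma periodize_apply_emod (L i : ℕ) (x : ℤ → M) (n : ℤ) :
    periodize L i x n = periodize L i x (n % L) := by
  simp [periodize]

lemma periodize_apply_of_mem {L i : ℕ} (x : ℤ → M) {n : ℤ} (h0 : 0 ≤ n + i) (h1 : n + i < L) :
    periodize L i x n = x n := by
  simp [periodize, Int.emod_eq_of_lt h0 h1]

lemma finite_setOf_periodic {C : Set M} (hC : C.Finite) {L : ℕ} (hL : L ≠ 0) :
    {x : ℤ → M | ∀ n, x n ∈ C ∧ x n = x (n % L)}.Finite := by
  have : Finite C := hC
  refine Set.Finite.of_injOn (f := fun x : ℤ → M => fun k : Fin L => x k)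
    (t := Set.univ.pi fun _ => C) (fun x hx k _ => (hx k).1) (fun x hx y hy hxy => ?_)
    (Set.Finite.pi fun _ => hC)
  ext n
  rw [(hx n).2, (hy n).2]
  have h0 := Int.emod_nonneg n (Int.natCast_ne_zero.2 hL)
  have h1 := Int.emod_lt_of_pos n (Int.natCast_pos.2 hL.pos)
  have h := congrFun hxy ⟨(n % L).toNat, by omega⟩
  simpa [Int.toNat_of_nonneg h0] using h

variable [MeasurableSpace M]

lemma measurable_periodize (L i : ℕ) : Measurable (periodize L i : (ℤ → M) → ℤ → M) :=
  measurable_pi_lambda _ fun _ => measurable_pi_apply _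

lemma map_shift_map_periodize_succ {μ : Measure (ℤ → M)} (hμ : MeasurePreserving (shift M) μ μ)
    (L i : ℕ) : (μ.map (periodize L (i + 1))).map (shift M) = μ.map (periodize L i) := by
  rw [Measure.map_map measurable_shift (measurable_periodize _ _)]
  conv_rhs => rw [← hμ.map_eq, Measure.map_map (measurable_periodize _ _) measurable_shift]
  congr 1
  ext1 x
  exact shift_periodize_succ L i x

lemma map_periodize_self {μ : Measure (ℤ → M)} (hμ : MeasurePreserving (shift M) μ μ) (L : ℕ) :
    μ.map (periodize L L) = μ.map (periodize L 0) := by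
  conv_rhs => rw [← (hμ.iterate L).map_eq,
    Measure.map_map (measurable_periodize _ _) (hμ.iterate L).measurable]
  congr 1
  ext1 x
  exact periodize_self L x

/-- The average of the laws of the `L` periodizations with period `L`. -/
noncomputable def periodicMeasure (μ : Measure (ℤ → M)) (L : ℕ) : Measure (ℤ → M) :=
  (L : ENNReal)⁻¹ • ∑ i ∈ Finset.range L, μ.map (periodize L i)

lemma periodicMeasure_eq_one {μ : Measure (ℤ → M)} {L : ℕ} (hL : L ≠ 0) {S : Set (ℤ → M)}
    (h : ∀ i, μ.map (periodize L i) S = 1) : periodicMeasure μ L S = 1 := by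
  simp [periodicMeasure, h, ENNReal.inv_mul_cancel, hL]

/-- The shift sends the law with offset `i + 1` to the one with offset `i`, and offsets `0` and `L`
have the same law because `μ` is invariant. The `L` laws are permuted cyclically. -/
lemma measurePreserving_periodicMeasure {μ : Measure (ℤ → M)}
    (hμ : MeasurePreserving (shift M) μ μ) {L : ℕ} (hL : L ≠ 0) :
    MeasurePreserving (shift M) (periodicMeasure μ L) (periodicMeasure μ L) := by
  refine ⟨measurable_shift, ?_⟩
  obtain ⟨l, rfl⟩ := Nat.exists_eq_succ_of_ne_zero hL
  rw [periodicMeasure, Measure.map_smul, Measure.map_finset_sum measurable_shift.aemeasurable,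
    Finset.sum_range_succ', Finset.sum_range_succ _ l, ← map_periodize_self hμ]
  simp only [Nat.succ_eq_add_one, map_shift_map_periodize_succ hμ]

/-- The invariant measure `periodicMeasure μ (l + 1)`. -/
noncomputable def InvariantMeasure.periodic (μ : InvariantMeasure M) (l : ℕ) :
    InvariantMeasure M :=
  ⟨⟨periodicMeasure (μ.1 : Measure (ℤ → M)) (l + 1), ⟨periodicMeasure_eq_one l.succ_ne_zero fun i => by
    rw [Measure.map_apply (measurable_periodize _ _) MeasurableSet.univ]
    simp⟩⟩, measurePreserving_periodicMeasure μ.2 l.succ_ne_zero⟩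

end Periodize

/-! ### Density of finitely supported invariant measures -/

section Convergence

variable {M : Type*} [MetricSpace M] [CompactSpace M]

/-- By compactness `f` is uniformly continuous, and every entourage of the product contains the
relation of agreement on some window `[-K, K]`. -/
lemma exists_forall_eq_imp_dist_lt {f : (ℤ → M) → ℝ} (hf : Continuous f) {η : ℝ} (hη : 0 < η) :
    ∃ K : ℕ, ∀ x y : ℤ → M, (∀ n : ℤ, n.natAbs ≤ K → x n = y n) → dist (f x) (f y) < η := by
  have hu := CompactSpace.uniformContinuous_of_continuous hf (Metric.dist_mem_uniformity hη)
  let E : ℕ → Set ((ℤ → M) × (ℤ → M)) := fun K => {p | ∀ n : ℤ, n.natAbs ≤ K → p.1 n = p.2 n}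
  have hE : ⨅ K, 𝓟 (E K) ≤ uniformity (ℤ → M) := by
    rw [Pi.uniformity]
    refine le_iInf fun n => ?_
    rw [← tendsto_iff_comap]
    refine tendsto_iInf' n.natAbs fun s hs => ?_
    rw [mem_map, mem_principal]
    intro p hp
    rw [Set.mem_preimage, hp n le_rfl]
    exact refl_mem_uniformity hs
  have hd : Directed (· ≥ ·) fun K => 𝓟 (E K) := by
    refine directed_of_isDirected_le fun i j hij => principal_mono.2 fun p hp n hn => ?_
    exact hp n (hn.trans hij)
  obtain ⟨K, hK⟩ := (mem_iInf_of_directed hd _).1 (hE (mem_map.1 hu))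
  exact ⟨K, fun x y h => mem_principal.1 hK (show (x, y) ∈ E K from h)⟩

variable [MeasurableSpace M] [BorelSpace M]

/-- The window `[-i, L - i)` contains `[-K, K]` except for at most `2 * K` offsets near the ends,
each of which costs at most `2 * ‖f‖`. -/
lemma dist_integral_periodicMeasure_le {μ : Measure (ℤ → M)} [IsProbabilityMeasure μ]
    (f : BoundedContinuousFunction (ℤ → M) ℝ) {η : ℝ} (hη : 0 ≤ η) {K : ℕ}
    (hK : ∀ x y : ℤ → M, (∀ n : ℤ, n.natAbs ≤ K → x n = y n) → dist (f x) (f y) < η)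
    {L : ℕ} (hL : L ≠ 0) :
    dist (∫ x, f x ∂(periodicMeasure μ L)) (∫ x, f x ∂μ) ≤
      η + 2 * K * (2 * ‖f‖) * (L : ℝ)⁻¹ := by
  have hL0 : (0 : ℝ) < L := by exact_mod_cast hL.pos
  have hfi (i : ℕ) : Integrable f (μ.map (periodize L i)) := by
    have := Measure.isProbabilityMeasure_map (μ := μ) (measurable_periodize L i).aemeasurable
    exact f.integrable _
  have h1 : ∫ x, f x ∂(periodicMeasure μ L) =
      (L : ℝ)⁻¹ * ∑ i ∈ Finset.range L, ∫ x, f (periodize L i x) ∂μ := by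
    rw [periodicMeasure, integral_smul_measure, integral_finsetSum_measure fun i _ => hfi i]
    simp only [ENNReal.toReal_inv, ENNReal.toReal_natCast, smul_eq_mul]
    congr 1
    exact Finset.sum_congr rfl fun i _ => integral_map (measurable_periodize L i).aemeasurable
      f.continuous.aestronglyMeasurable
  have h2 : ∫ x, f x ∂μ = (L : ℝ)⁻¹ * ∑ i ∈ Finset.range L, ∫ x, f x ∂μ := by
    rw [Finset.sum_const, Finset.card_range, nsmul_eq_mul, inv_mul_cancel_left₀ hL0.ne']
  have hint (i : ℕ) : Integrable (fun x => f (periodize L i x)) μ :=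
    (hfi i).comp_measurable (measurable_periodize L i)
  have hterm (i : ℕ) (hi : i < L) : ‖(∫ x, f (periodize L i x) ∂μ) - ∫ x, f x ∂μ‖ ≤
      η + if i ∈ Finset.range K ∪ Finset.Ico (L - K) L then 2 * ‖f‖ else 0 := by
    rw [← integral_sub (hint i) (f.integrable μ)]
    refine (norm_integral_le_of_norm_le_const (ae_of_all _ fun x => ?_)).trans_eq
      (by rw [probReal_univ, mul_one])
    split_ifs with h
    · have := f.dist_le_two_norm (periodize L i x) x
      rw [dist_eq_norm] at this
      linarith
    · rw [add_zero, ← dist_eq_norm]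
      simp only [Finset.mem_union, Finset.mem_range, Finset.mem_Ico] at h
      exact (hK _ _ fun n hn => periodize_apply_of_mem x (by omega) (by omega)).le
  rw [h1, h2, dist_eq_norm, ← mul_sub, ← Finset.sum_sub_distrib, norm_mul,
    Real.norm_of_nonneg (inv_nonneg.2 hL0.le)]
  have hsum : ∑ i ∈ Finset.range L, (η + if i ∈ Finset.range K ∪ Finset.Ico (L - K) L
      then 2 * ‖f‖ else 0) ≤ L * η + 2 * K * (2 * ‖f‖) := by
    rw [Finset.sum_add_distrib, Finset.sum_const, Finset.card_range, nsmul_eq_mul,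
      Finset.sum_ite_mem, Finset.sum_const, nsmul_eq_mul]
    gcongr
    have hcard := (Finset.card_le_card (Finset.inter_subset_right (s₁ := Finset.range L)
      (s₂ := Finset.range K ∪ Finset.Ico (L - K) L))).trans (Finset.card_union_le _ _)
    rw [Finset.card_range, Nat.card_Ico] at hcard
    exact_mod_cast hcard.trans (by omega)
  calc (L : ℝ)⁻¹ * ‖∑ i ∈ Finset.range L, ((∫ x, f (periodize L i x) ∂μ) - ∫ x, f x ∂μ)‖
      ≤ (L : ℝ)⁻¹ * (L * η + 2 * K * (2 * ‖f‖)) := by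
        gcongr
        exact (norm_sum_le _ _).trans ((Finset.sum_le_sum fun i hi => hterm i (Finset.mem_range.1 hi)).trans hsum)
    _ = _ := by field_simp

lemma InvariantMeasure.tendsto_periodic (μ : InvariantMeasure M) :
    Tendsto μ.periodic atTop (𝓝 μ) := by
  rw [tendsto_subtype_rng, ProbabilityMeasure.tendsto_iff_forall_integral_tendsto]
  intro f
  rw [Metric.tendsto_atTop']
  intro η hη
  obtain ⟨K, hK⟩ := exists_forall_eq_imp_dist_lt f.continuous (half_pos hη)
  have hlim : Tendsto (fun l : ℕ => 2 * K * (2 * ‖f‖) * ((l + 1 : ℕ) : ℝ)⁻¹) atTop (𝓝 0) := by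
    simpa using ((tendsto_inv_atTop_nhds_zero_nat (𝕜 := ℝ)).comp (tendsto_add_atTop_nat 1)).const_mul
      (2 * K * (2 * ‖f‖))
  obtain ⟨l₀, hl₀⟩ := eventually_atTop.1 (hlim.eventually_lt_const (half_pos hη))
  refine ⟨l₀, fun l hl => ?_⟩
  refine (dist_integral_periodicMeasure_le f (half_pos hη).le hK l.succ_ne_zero).trans_lt ?_
  have := hl₀ l hl.le
  simp only [Nat.succ_eq_add_one]
  linarith

/-- Invariant measures carried by finitely many sequences. -/
def finitelySupported (M : Type*) [MeasurableSpace M] : Set (InvariantMeasure M) :=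
  {μ | ∃ F : Set (ℤ → M), F.Finite ∧ (μ.1 : Measure (ℤ → M)) F = 1}

lemma InvariantMeasure.periodic_mem_finitelySupported {μ : InvariantMeasure M}
    (hμ : μ ∈ finiteAlphabet M) (l : ℕ) : μ.periodic l ∈ finitelySupported M := by
  obtain ⟨C, hC, h⟩ := hμ
  have hF := finite_setOf_periodic hC l.succ_ne_zero
  refine ⟨_, hF, periodicMeasure_eq_one l.succ_ne_zero fun i => ?_⟩
  rw [Measure.map_apply (measurable_periodize _ _) hF.measurableSet]
  refine le_antisymm prob_le_one (h.ge.trans (measure_mono fun x hx n => ⟨hx _, ?_⟩))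
  exact periodize_apply_emod _ _ _ _

lemma dense_finitelySupported : Dense (finitelySupported M) :=
  dense_closure.1 (dense_finiteAlphabet.mono fun μ hμ =>
    mem_closure_of_tendsto μ.tendsto_periodic
      (Eventually.of_forall (InvariantMeasure.periodic_mem_finitelySupported hμ)))

end Convergence

/-! ### Residual sets and the two families of conditions -/

lemma iInter_mem_residual_of_dense {Y : Type*} [TopologicalSpace Y] {D : Set Y} (hD : Dense D)
    {P : ℕ → Set Y} (h : ∀ m, D ⊆ interior (P m)) : ⋂ m, P m ∈ residual Y :=
  countable_iInter_mem.2 fun m => mem_of_superset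
    (residual_of_dense_open isOpen_interior (hD.mono (h m))) interior_subset

lemma frequently_nhdsGT_zero {p : ℝ → Prop}
    (h : ∀ m : ℕ, ∃ ε, 0 < ε ∧ ε < 1 / ((m : ℝ) + 1) ∧ p ε) : ∃ᶠ ε in 𝓝[>] (0 : ℝ), p ε := by
  rw [(nhdsGT_basis (0 : ℝ)).frequently_iff]
  intro δ hδ
  obtain ⟨m, hm⟩ := exists_nat_one_div_lt hδ
  obtain ⟨ε, h0, h1, h2⟩ := h m
  exact ⟨ε, ⟨h0, h1.trans hm⟩, h2⟩

variable {M : Type*} [MetricSpace M] [CompactSpace M] [MeasurableSpace M] [BorelSpace M]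
  {a : ℕ → ℝ}

/-- Portmanteau: the mass of an open set is lower semicontinuous. -/
lemma isOpen_setOf_lt_measureReal {V : Set (ℤ → M)} (hV : IsOpen V) (c : ℝ) :
    IsOpen {μ : InvariantMeasure M | c < (μ.1 : Measure (ℤ → M)).real V} := by
  refine IsOpen.preimage (t := {μ : ProbabilityMeasure (ℤ → M) | c < (μ : Measure _).real V})
    continuous_subtype_val (isOpen_iff_mem_nhds.2 fun μ hμ => ?_)
  rcases lt_or_ge c 0 with hc | hc
  · exact Eventually.of_forall fun ν => hc.trans_le measureReal_nonneg
  · have h1 : ENNReal.ofReal c < (μ : Measure (ℤ → M)) V :=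
      (ENNReal.ofReal_lt_iff_lt_toReal hc (measure_ne_top _ _)).2 hμ
    have h2 := ProbabilityMeasure.le_liminf_measure_open_of_tendsto (tendsto_id (x := 𝓝 μ)) hV
    filter_upwards [eventually_lt_of_lt_liminf (h1.trans_le h2)] with ν hν
    exact (ENNReal.ofReal_lt_iff_lt_toReal hc (measure_ne_top _ _)).1 hν

/-- Invariant measures with a small entropy quotient at a scale below `1 / (m + 1)`. -/
def smallQuotient (M : Type*) [MetricSpace M] [MeasurableSpace M] (a : ℕ → ℝ) (m : ℕ) :
    Set (InvariantMeasure M) :=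
  {μ | ∃ ε, 0 < ε ∧ ε < 1 / ((m : ℝ) + 1) ∧
    entropyQuotient a (μ.1 : Measure (ℤ → M)) ε < 1 / ((m : ℝ) + 1)}

/-- Invariant measures with a large entropy quotient at a scale below `1 / (m + 1)`. -/
def largeQuotient (M : Type*) [MetricSpace M] [MeasurableSpace M] (a : ℕ → ℝ) (m : ℕ) :
    Set (InvariantMeasure M) :=
  {μ | ∃ ε, 0 < ε ∧ ε < 1 / ((m : ℝ) + 1) ∧
    (m : ℝ) < entropyQuotient a (μ.1 : Measure (ℤ → M)) ε}

omit [BorelSpace M] in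
lemma lowerEntropyDim_eq_zero {μ : InvariantMeasure M} (h : ∀ m, μ ∈ smallQuotient M a m) :
    lowerEntropyDim a (μ.1 : Measure (ℤ → M)) = 0 := by
  refine le_antisymm ?_ ?_
  · refine EReal.le_of_forall_lt_iff_le.1 fun r hr => ?_
    have hr' : 0 < r := EReal.coe_pos.1 hr
    refine liminf_le_of_frequently_le (frequently_nhdsGT_zero fun m => ?_)
    obtain ⟨k, hk⟩ := exists_nat_one_div_lt hr'
    -- The index `m` controls the scale and `k` the quotient.
    obtain ⟨ε, h0, h1, h2⟩ := h (max m k)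
    have hm : 1 / (((max m k : ℕ) : ℝ) + 1) ≤ 1 / ((m : ℝ) + 1) :=
      Nat.one_div_le_one_div (le_max_left _ _)
    have hk' : 1 / (((max m k : ℕ) : ℝ) + 1) ≤ 1 / ((k : ℝ) + 1) :=
      Nat.one_div_le_one_div (le_max_right _ _)
    exact ⟨ε, h0, h1.trans_le hm, EReal.coe_le_coe_iff.2 (h2.le.trans (hk'.trans hk.le))⟩
  · refine le_liminf_of_le (by isBoundedDefault) ?_
    filter_upwards [Ioo_mem_nhdsGT (zero_lt_one' ℝ)] with ε hε
    exact EReal.coe_nonneg.2 (entropyQuotient_nonneg hε.1 hε.2)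

omit [CompactSpace M] [BorelSpace M] in
lemma upperEntropyDim_eq_top {μ : InvariantMeasure M} (h : ∀ m, μ ∈ largeQuotient M a m) :
    upperEntropyDim a (μ.1 : Measure (ℤ → M)) = ⊤ := by
  refine (EReal.eq_top_iff_forall_lt _).2 fun r => ?_
  have hr : (r : EReal) < ((r + 1 : ℝ) : EReal) := EReal.coe_lt_coe_iff.2 (lt_add_one r)
  refine hr.trans_le (le_limsup_of_frequently_le (frequently_nhdsGT_zero fun m => ?_))
  obtain ⟨k, hk⟩ := exists_nat_gt (r + 1)
  obtain ⟨ε, h0, h1, h2⟩ := h (max m k)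
  have hm : 1 / (((max m k : ℕ) : ℝ) + 1) ≤ 1 / ((m : ℝ) + 1) :=
    Nat.one_div_le_one_div (le_max_left _ _)
  have hk' : (k : ℝ) ≤ (max m k : ℕ) := Nat.cast_le.2 (le_max_right _ _)
  exact ⟨ε, h0, h1.trans_le hm, EReal.coe_le_coe_iff.2 (hk.le.trans (hk'.trans h2.le))⟩

lemma finitelySupported_subset_interior (ha : IsSubexponential a) (m : ℕ) :
    finitelySupported M ⊆ interior (smallQuotient M a m) := by
  rintro μ ⟨F, hF, hμ⟩
  lift F to Finset (ℤ → M) using hF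
  have hFne : F.Nonempty := by
    rw [← Finset.coe_nonempty]
    exact nonempty_of_measure_ne_zero (by rw [hμ]; exact one_ne_zero)
  have hm : (0 : ℝ) < (m : ℝ) + 1 := by positivity
  -- The `3` is the `2` of `integral_neg_log_measureReal_ball_le` plus `1` for the mass away from
  -- `F`.
  obtain ⟨ε, ⟨h0, h1⟩, hε⟩ : ∃ ε : ℝ, ε ∈ Set.Ioo 0 (1 / ((m : ℝ) + 1)) ∧
      Real.log ε < -(((m : ℝ) + 1) * (Real.log F.card + 3)) :=
    ((eventually_mem_set.2 (Ioo_mem_nhdsGT (one_div_pos.2 hm))).and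
      (Real.tendsto_log_nhdsGT_zero.eventually_lt_atBot _)).exists
  choose U hUo hxU hU using fun x : ℤ → M => exists_isOpen_seqDist_lt ha x h0
  obtain ⟨t, V, hVo, hV, ht⟩ := exists_finite_cover_seqDist_lt (M := M) ha h0
  have htne : t.Nonempty := by
    obtain ⟨x, -⟩ := hFne
    obtain ⟨y, hy, -⟩ := Set.mem_iUnion₂.1 (ht.ge (Set.mem_univ x))
    exact ⟨y, hy⟩
  have hlog : 0 ≤ Real.log t.card := Real.log_natCast_nonneg _
  -- The cover `t` depends only on `ε`, so the mass threshold may depend on `t`: the remainder then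
  -- contributes at most `1`.
  refine mem_interior.2 ⟨_, fun ν hν => ?_, isOpen_setOf_lt_measureReal
    (isOpen_biUnion fun x (_ : x ∈ F) => hUo x) (1 - 1 / (Real.log t.card + 1)), ?_⟩
  · refine ⟨ε, h0, h1, ?_⟩
    have hν' : 1 - 1 / (Real.log t.card + 1) <
      (ν.1 : Measure (ℤ → M)).real (⋃ x ∈ F, U x) := hν
    have hb := integral_neg_log_measureReal_ball_le (μ := (ν.1 : Measure (ℤ → M))) ha h0
      F U (fun x => (hUo x).measurableSet) hU hFne t V (fun x => (hVo x).measurableSet) hV htne ht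
    have hc : (1 - (ν.1 : Measure (ℤ → M)).real (⋃ x ∈ F, U x)) * Real.log t.card ≤ 1 :=
      calc _ ≤ 1 / (Real.log t.card + 1) * Real.log t.card :=
            mul_le_mul_of_nonneg_right (by linarith) hlog
        _ ≤ 1 := by rw [one_div_mul_eq_div, div_le_one (by positivity)]; linarith
    have hpos : 0 < Real.log F.card + 3 := by
      have := Real.log_natCast_nonneg F.card
      positivity
    have hε0 : 0 < -Real.log ε := by
      have := mul_pos hm hpos
      linarith
    rw [entropyQuotient_eq, div_lt_div_iff₀ hε0 hm, mul_comm, one_mul]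
    calc _ ≤ ((m : ℝ) + 1) * (Real.log F.card + 3) := by gcongr; linarith
      _ < _ := by linarith
  · have hone : (μ.1 : Measure (ℤ → M)) (⋃ x ∈ F, U x) = 1 :=
      le_antisymm prob_le_one (hμ.ge.trans (measure_mono fun x hx =>
        Set.mem_biUnion hx (hxU x)))
    have : 0 < 1 / (Real.log t.card + 1) := by positivity
    have hone' : (μ.1 : Measure (ℤ → M)).real (⋃ x ∈ F, U x) = 1 := by
      rw [Measure.real, hone, ENNReal.toReal_one]
    refine lt_of_lt_of_eq ?_ hone'.symm
    linarith

omit [CompactSpace M] [MeasurableSpace M] [BorelSpace M] in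
lemma exists_pos_le_dist_of_finite {C : Set M} (hC : C.Finite) :
    ∃ δ : ℝ, 0 < δ ∧ ∀ x ∈ C, ∀ y ∈ C, x ≠ y → δ ≤ dist x y := by
  have : Finite C := hC
  obtain ⟨δ, h0, hδ⟩ := ENNReal.lt_iff_exists_real_btwn.1 (Set.einfsep_pos_of_finite (s := C))
  refine ⟨δ, ENNReal.ofReal_pos.1 hδ.1, fun x hx y hy hxy => ?_⟩
  have h := hδ.2.le.trans (Set.einfsep_le_edist_of_mem hx hy hxy)
  rw [edist_dist] at h
  exact (ENNReal.ofReal_le_ofReal_iff dist_nonneg).1 h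

lemma IsSubexponential.eventually_log_lt (ha : IsSubexponential a) {α : ℝ} (hα : 0 < α) :
    ∀ᶠ N : ℕ in atTop, Real.log (a N + 1) < α * N := by
  have h1 : Tendsto (fun N : ℕ => 1 / Real.exp (α * N)) atTop (𝓝 0) := by
    simp only [one_div]
    exact (Real.tendsto_exp_atTop.comp
      (tendsto_natCast_atTop_atTop.const_mul_atTop hα)).inv_tendsto_atTop
  have h2 := (ha.tendsto α hα).add h1
  rw [add_zero] at h2
  filter_upwards [h2.eventually_lt_const one_pos] with N hN
  rw [← add_div, div_lt_one (Real.exp_pos _)] at hN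
  exact (Real.log_lt_iff_lt_exp (by linarith [ha.neg_one_lt N])).2 hN

/-! ### Separation of words and large quotients -/

section Words

/-- The sequences whose symbols at the positions in `[-N, N]` are within `ρ` of the word `w`. -/
def wordNhd {C : Set M} (ρ : ℝ) (N : ℕ) (w : Finset.Icc (-(N : ℤ)) N → C) : Set (ℤ → M) :=
  {x | ∀ n : Finset.Icc (-(N : ℤ)) N, dist (x n) (w n) < ρ}

omit [CompactSpace M] [MeasurableSpace M] [BorelSpace M] in
lemma isOpen_wordNhd {C : Set M} (ρ : ℝ) (N : ℕ) (w : Finset.Icc (-(N : ℤ)) N → C) :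
    IsOpen (wordNhd ρ N w) := by
  rw [wordNhd, Set.ofPred_forall]
  exact isOpen_iInter_of_finite fun n =>
    isOpen_lt ((continuous_apply (n : ℤ)).dist continuous_const) continuous_const

-- Where the words differ, the triangle inequality leaves `x` and `y` at least `ρ` apart. That
-- single term of the metric is then at least the weight at `|n|`, which is no smaller than the
-- weight at `N`.
omit [CompactSpace M] [MeasurableSpace M] [BorelSpace M] in
lemma ball_subset_compl_wordNhd (ha : IsSubexponential a) {C : Set M} {ρ : ℝ}
    (hC : ∀ x ∈ C, ∀ y ∈ C, x ≠ y → 3 * ρ ≤ dist x y) {N : ℕ} (hN : 1 / (a N + 1) ≤ ρ)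
    {w w' : Finset.Icc (-(N : ℤ)) N → C} (hw : w' ≠ w) {x : ℤ → M} (hx : x ∈ wordNhd ρ N w) :
    ball a x (1 / (a N + 1)) ⊆ (wordNhd ρ N w')ᶜ := by
  intro y hy hy'
  obtain ⟨n, hn⟩ := Function.ne_iff.1 hw
  have h1 := hC _ (w n).2 _ (w' n).2 fun h => hn (Subtype.ext h.symm)
  have h2 := dist_triangle4 (w n : M) (x n) (y n) (w' n)
  have h3 := hx n
  have h4 := hy' n
  rw [dist_comm] at h3
  have h5 : 1 / (a N + 1) ≤ dist (x n) (y n) := by linarith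
  have hnN : (n : ℤ).natAbs ≤ N := by
    have := Finset.mem_Icc.1 n.2
    omega
  have h6 : 1 / (a N + 1) ≤ 1 / (a (n : ℤ).natAbs + 1) :=
    one_div_le_one_div_of_le (by linarith [ha.neg_one_lt (n : ℤ).natAbs])
      (by linarith [ha.monotone hnN])
  have h7 := (le_min h6 h5).trans (min_le_seqDist ha x y n)
  exact absurd h7 (not_le.2 hy)

lemma smallCylinders_subset_interior (ha : IsSubexponential a) (m : ℕ) :
    smallCylinders M ⊆ interior (largeQuotient M a m) := by
  rintro μ ⟨⟨C, hC, hμC⟩, hcyl⟩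
  have : Finite C := hC
  obtain ⟨δ, hδ, hδC⟩ := exists_pos_le_dist_of_finite hC
  have hm : (0 : ℝ) < (m : ℝ) + 1 := by positivity
  have hlog2 : 0 < Real.log 2 := Real.log_pos one_lt_two
  have hw := ha.summable.tendsto_atTop_zero
  obtain ⟨N, hNδ, hNm, hNlog⟩ := ((hw.eventually_le_const (show 0 < δ / 3 by positivity)).and
    ((hw.eventually_lt_const (one_div_pos.2 hm)).and
      (ha.eventually_log_lt (div_pos hlog2 hm)))).exists
  have hε := ha.weight_pos N
  set U := wordNhd (C := C) (δ / 3) N with hU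
  have hUo := isOpen_wordNhd (C := C) (δ / 3) N
  -- The window has `2 * N + 1` positions, so its cylinders have `μ`-measure at most `s / 2`; the
  -- factor 2 leaves room for a strict, open condition.
  set s : ℝ := 2⁻¹ ^ (2 * N) with hs
  have hs0 : 0 < s := by positivity
  -- Smallness of balls is expressed by lower bounds on open sets: a ball around a point near `w`
  -- misses the neighbourhoods of all other words, which carry mass above `1 - s`.
  let O : Set (InvariantMeasure M) := {ν | 1 / 2 < (ν.1 : Measure (ℤ → M)).real (⋃ w, U w)} ∩
    ⋂ w, {ν | 1 - s < (ν.1 : Measure (ℤ → M)).real (⋃ w' ≠ w, U w')}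
  have hO : IsOpen O := (isOpen_setOf_lt_measureReal (isOpen_iUnion hUo) _).inter
    (isOpen_iInter_of_finite fun w =>
      isOpen_setOf_lt_measureReal (isOpen_biUnion fun w' _ => hUo w') _)
  refine mem_interior.2 ⟨O, fun ν hν => ⟨1 / (a N + 1), hε, hNm, ?_⟩, hO, ?_, ?_⟩
  · have hball : ∀ x ∈ ⋃ w, U w, (ν.1 : Measure (ℤ → M)).real (ball a x (1 / (a N + 1))) ≤ s := by
      intro x hx
      obtain ⟨w, hxw⟩ := Set.mem_iUnion.1 hx
      have hνw : 1 - s < (ν.1 : Measure (ℤ → M)).real (⋃ w' ≠ w, U w') := Set.mem_iInter.1 hν.2 w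
      have hsub : ball a x (1 / (a N + 1)) ⊆ (⋃ w' ≠ w, U w')ᶜ := by
        intro y hy hy'
        obtain ⟨w', hw', hyw⟩ := Set.mem_iUnion₂.1 hy'
        exact ball_subset_compl_wordNhd ha
          (fun p hp q hq hpq => by linarith [hδC p hp q hq hpq]) hNδ hw' hxw hy hyw
      have h := measureReal_mono (μ := (ν.1 : Measure (ℤ → M))) hsub
      have hmeas : MeasurableSet (⋃ w' ≠ w, U w') :=
        (isOpen_biUnion fun w' _ => hUo w').measurableSet
      rw [probReal_compl_eq_one_sub hmeas] at h
      linarith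
    have hν1 : 1 / 2 < (ν.1 : Measure (ℤ → M)).real (⋃ w, U w) := hν.1
    have h := le_integral_neg_log_measureReal_ball ha hε (isOpen_iUnion hUo).measurableSet hball
    have hlogs : -Real.log s = 2 * N * Real.log 2 := by
      rw [hs, Real.log_pow, Real.log_inv]; push_cast; ring
    have hNs : N * Real.log 2 ≤ ∫ x, -Real.log ((ν.1 : Measure (ℤ → M)).real
        (ball a x (1 / (a N + 1)))) ∂(ν.1 : Measure (ℤ → M)) := by
      refine le_trans ?_ h
      rw [hlogs]
      have : 0 ≤ 2 * (N : ℝ) * Real.log 2 := by positivity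
      nlinarith
    have hlog0 : 0 < Real.log (a N + 1) := by
      have h1 : (1 : ℝ) / (m + 1) ≤ 1 := by
        rw [div_le_one hm]; linarith [(Nat.cast_nonneg m : (0 : ℝ) ≤ m)]
      have h2 := Real.log_neg hε (hNm.trans_le h1)
      rw [one_div, Real.log_inv] at h2
      linarith
    rw [entropyQuotient_eq]
    conv_rhs => rw [one_div, Real.log_inv, neg_neg, ← one_div]
    rw [lt_div_iff₀ hlog0]
    rw [div_mul_eq_mul_div, lt_div_iff₀ hm] at hNlog
    nlinarith
  · have hone : (μ.1 : Measure (ℤ → M)) (⋃ w, U w) = 1 := by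
      refine le_antisymm prob_le_one (hμC.ge.trans (measure_mono fun x hx => ?_))
      refine Set.mem_iUnion.2 ⟨fun n => ⟨x n, hx n⟩, fun n => ?_⟩
      simpa using hδ
    simp only [Set.mem_ofPred_eq, Measure.real, hone, ENNReal.toReal_one]
    norm_num
  · refine Set.mem_iInter.2 fun w => ?_
    rw [Set.mem_ofPred_eq]
    -- Outside the window the value of `v` is immaterial.
    let v : ℤ → M := fun n => if h : n ∈ Finset.Icc (-(N : ℤ)) N then w ⟨n, h⟩ else
      w ⟨0, by simp⟩
    have hcov : {x : ℤ → M | ∀ n, x n ∈ C} ⊆ (⋃ w' ≠ w, U w') ∪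
        {x | ∀ n ∈ Finset.Icc (-(N : ℤ)) N, x n = v n} := by
      intro x hx
      by_cases h : (fun n : Finset.Icc (-(N : ℤ)) N => (⟨x n, hx n⟩ : C)) = w
      · right
        intro n hn
        simp only [v, dif_pos hn, ← h]
      · left
        refine Set.mem_iUnion₂.2 ⟨_, h, fun n => ?_⟩
        simpa using hδ
    have h1 : 1 ≤ (μ.1 : Measure (ℤ → M)).real (⋃ w' ≠ w, U w') + (μ.1 : Measure (ℤ → M)).real
        {x | ∀ n ∈ Finset.Icc (-(N : ℤ)) N, x n = v n} := by
      refine le_trans ?_ ((measureReal_mono hcov).trans (measureReal_union_le _ _))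
      rw [Measure.real, hμC, ENNReal.toReal_one]
    have h2 : (μ.1 : Measure (ℤ → M)).real {x | ∀ n ∈ Finset.Icc (-(N : ℤ)) N, x n = v n} ≤
        2⁻¹ ^ (2 * N + 1) := by
      have h := ENNReal.toReal_mono (by simp) (hcyl (Finset.Icc (-(N : ℤ)) N) v)
      have hcard : (Finset.Icc (-(N : ℤ)) N).card = 2 * N + 1 := by
        rw [Int.card_Icc]; omega
      rw [hcard] at h
      simpa [Measure.real] using h
    have h3 : (2⁻¹ : ℝ) ^ (2 * N + 1) = s / 2 := by rw [pow_succ, ← hs]; ring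
    linarith

end Words

end FullShift

theorem corollary1p4 {M : Type*} [MetricSpace M] [CompactSpace M] [PerfectSpace M]
    [MeasurableSpace M] [BorelSpace M] (a : ℕ → ℝ) (ha : FullShift.IsSubexponential a) :
    {μ : FullShift.InvariantMeasure M |
        FullShift.lowerEntropyDim a (μ.1 : Measure (ℤ → M)) = 0} ∈
      residual (FullShift.InvariantMeasure M) ∧
    {μ : FullShift.InvariantMeasure M |
        FullShift.upperEntropyDim a (μ.1 : Measure (ℤ → M)) = ⊤} ∈
      residual (FullShift.InvariantMeasure M) := by
  constructor
  · refine mem_of_superset (FullShift.iInter_mem_residual_of_dense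
      FullShift.dense_finitelySupported (FullShift.finitelySupported_subset_interior ha)) ?_
    exact fun μ hμ => FullShift.lowerEntropyDim_eq_zero (Set.mem_iInter.1 hμ)
  · refine mem_of_superset (FullShift.iInter_mem_residual_of_dense
      FullShift.dense_smallCylinders (FullShift.smallCylinders_subset_interior ha)) ?_
    exact fun μ hμ => FullShift.upperEntropyDim_eq_top (Set.mem_iInter.1 hμ)
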